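/- Let $1\le p<\infty$, let $X,Y$ be real Banach spaces and let $U\subseteq X$ be open and convex. We use the following notions. - A bounded set $K\subseteq X$ is *Dunford–Pettis* if every weakly null sequence in $X^*$ converges to $0$ uniformly on $K$. - A sequence in $X$ is *$p$-Right null* if it is weakly $p$-summable (that is, $(x^*(x_n))_n\in\ell_p$ for every $x^*\in X^*$) and its set of terms is Dunford–Pettis. A sequence is *Right Cauchy* if it is weakly Cauchy and its set of terms is Dunford–Pettis. - $DPC_p(X,Y)$ is the set of bounded linear operators $T:X\to Y$ with $\|T(x_n)\|\to0$ for every $p$-Right null sequence $(x_n)$ in $X$, with the operator norm. - A set $K\subseteq L(X,Y)$ of bounded linear operators is a *$p$-(DPL) set* if $\lim_n\sup_{T\in K}\|T(x_n)\|=0$ for every $p$-Right null sequence $(x_n)$ in $X$. - A set $B\subseteq U$ is *$U$-bounded* if it is bounded and has strictly positive distance to the boundary of $U$ (if $U=X$, this just means bounded). - A mapping from $U$ to a normed space is *$\tau_r$-sequentially continuous on $U$-bounded sets* if it takes every Right Cauchy sequence in $U$ whose set of terms is $U$-bounded to a norm convergent sequence. Let $f:U\to Y$ be (Fréchet) differentiable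 on $U$, with $f'(x)\in DPC_p(X,Y)$ for every $x\in U$, and suppose that $f':U\to DPC_p(X,Y)$ is $\tau_r$-sequentially continuous on $U$-bounded sets. Then for every $U$-bounded Dunford–Pettis set $K\subseteq U$, the set $f'(K)$ is a $p$-(DPL) set. -/

import Mathlib

open Filter Topology
open scoped ENNReal

section DunfordPettis

variable {X Y Z : Type*} [NormedAddCommGroup X] [NormedSpace ℝ X]
  [NormedAddCommGroup Y] [NormedSpace ℝ Y] [NormedAddCommGroup Z] [NormedSpace ℝ Z]

/-- A sequence in `X` is weakly null if every continuous linear functional sends it to a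
null sequence. -/
def IsWeaklyNull (x : ℕ → X) : Prop :=
  ∀ φ : X →L[ℝ] ℝ, Tendsto (fun n => φ (x n)) atTop (𝓝 0)

/-- A sequence in `X` is weakly Cauchy if every continuous linear functional sends it to a
Cauchy sequence of scalars. -/
def IsWeaklyCauchy (x : ℕ → X) : Prop :=
  ∀ φ : X →L[ℝ] ℝ, CauchySeq (fun n => φ (x n))

/-- A sequence in `X` is weakly `p`-summable if `(φ (x n))ₙ` belongs to `ℓ_p` for every continuous
linear functional `φ`. It is used for `1 ≤ p < ∞` only. -/
def IsWeaklyPSummable (p : ℝ≥0∞) (x : ℕ → X) : Prop :=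
  ∀ φ : X →L[ℝ] ℝ, Memℓp (fun n => φ (x n)) p

/-- A bounded set `K` in `X` is a Dunford–Pettis set if every weakly null sequence of the dual
`X* = (X →L[ℝ] ℝ)` converges to zero uniformly on `K`. -/
def IsDunfordPettisSet (K : Set X) : Prop :=
  Bornology.IsBounded K ∧
    ∀ φ : ℕ → (X →L[ℝ] ℝ), IsWeaklyNull φ →
      TendstoUniformlyOn (fun n x => φ n x) (fun _ => (0 : ℝ)) atTop K

/-- A `p`-Right null sequence: weakly `p`-summable, and its terms form a Dunford–Pettis set. -/
def IsPRightNull (p : ℝ≥0∞) (x : ℕ → X) : Prop :=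
  IsWeaklyPSummable p x ∧ IsDunfordPettisSet (Set.range x)

/-- A Right Cauchy sequence: weakly Cauchy, and its terms form a Dunford–Pettis set. -/
def IsRightCauchy (x : ℕ → X) : Prop :=
  IsWeaklyCauchy x ∧ IsDunfordPettisSet (Set.range x)

/-- `B ⊆ U` is `U`-bounded if it is bounded and at strictly positive distance from the boundary
of `U`. The second condition is void if `U` has empty boundary. -/
def IsUBounded (U B : Set X) : Prop :=
  B ⊆ U ∧ Bornology.IsBounded B ∧ ∃ δ : ℝ, 0 < δ ∧ ∀ x ∈ B, ∀ z ∈ frontier U, δ ≤ dist x z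

/-- `τ_r`-sequential continuity on `U`-bounded sets (Right sequential continuity) of a mapping
`g` on `U`: it takes every `U`-bounded Right Cauchy sequence to a norm convergent sequence. -/
def IsRightSeqContinuousOn (U : Set X) (g : X → Z) : Prop :=
  ∀ x : ℕ → X, IsUBounded U (Set.range x) → IsRightCauchy x →
    ∃ z : Z, Tendsto (fun n => g (x n)) atTop (𝓝 z)

/-- The class `DPC_p(X, Y)` of Dunford–Pettis `p`-convergent operators: bounded operators taking
Dunford–Pettis weakly `p`-summable sequences to norm null sequences. -/
def DPC (p : ℝ≥0∞) (X Y : Type*) [NormedAddCommGroup X] [NormedSpace ℝ X]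
    [NormedAddCommGroup Y] [NormedSpace ℝ Y] : Set (X →L[ℝ] Y) :=
  {T | ∀ x : ℕ → X, IsPRightNull p x → Tendsto (fun n => T (x n)) atTop (𝓝 0)}

/-- A `p`-(DPL) set of operators: `lim_n sup_{T ∈ K} ‖T (x n)‖ = 0` for every `p`-Right null
sequence. The supremum is taken in `[0, ∞]`. -/
def IsPDPLSet (p : ℝ≥0∞) (K : Set (X →L[ℝ] Y)) : Prop :=
  ∀ x : ℕ → X, IsPRightNull p x →
    Tendsto (fun n => ⨆ T ∈ K, ‖T (x n)‖ₑ) atTop (𝓝 0)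

end DunfordPettis

/-! If the conclusion failed, there would be points `a k ∈ K` and a subsequence `x ∘ m` with `‖f'(a
k) (x (m k))‖` bounded away from `0`. Dunford–Pettis sets are weakly precompact, so `a` has a Right
Cauchy subsequence. Along it `f'` converges in norm, and this forces the values to `0`
(`IsPRightNull.tendsto_apply_of_tendsto`).

The weight lies on precompactness, `IsDunfordPettisSet.exists_isWeaklyCauchy_subseq`, a variant of
Rosenthal's `ℓ₁` argument. Without a weakly Cauchy subsequence there are rationals `r < s` and an
infinite index set such that, along each of its infinite subsets, some functional of the dual ball
is infinitely often above `s` and infinitely often below `r`. Then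
`NowhereConvergent.exists_independent` extracts terms separated by functionals in every sign
pattern. Averaging these functionals against Rademacher signs yields a weakly null sequence in the
dual bounded below on those terms, which the Dunford–Pettis property forbids. -/

section Independence

/-! ### Independent sequences of pairs of sets -/

variable {α : Type*}

/-- The point `d` lies in infinitely many of the sets `C true l` and in infinitely many of the sets
`C false l` with `l ∈ L`. -/
def OscillatesAlong (C : Bool → ℕ → Set α) (L : Set ℕ) (d : α) : Prop :=
  ∀ b, {l | l ∈ L ∧ d ∈ C b l}.Infinite

theorem OscillatesAlong.of_diff_finite {C : Bool → ℕ → Set α} {T L : Set ℕ} {d : α}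
    (h : OscillatesAlong C T d) (hTL : (T \ L).Finite) : OscillatesAlong C L d := by
  intro b
  refine ((h b).sdiff hTL).mono ?_
  rintro l ⟨⟨hlT, hld⟩, hl⟩
  exact ⟨by_contra fun hL => hl ⟨hlT, hL⟩, hld⟩

/-- Every infinite subset `L` of `M` has a point of `S` that oscillates along `L`. -/
def NowhereConvergent (C : Bool → ℕ → Set α) (S : Set α) (M : Set ℕ) : Prop :=
  ∀ L ⊆ M, L.Infinite → ∃ d ∈ S, OscillatesAlong C L d

theorem NowhereConvergent.mono {C : Bool → ℕ → Set α} {S : Set α} {M M' : Set ℕ}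
    (h : NowhereConvergent C S M) (hM : M' ⊆ M) : NowhereConvergent C S M' :=
  fun L hL => h L (hL.trans hM)

/-- Diagonal sequences: if every infinite subset of `M` can be thinned out at each stage, then
there is a strictly increasing sequence in `M` that is eventually in all the thinned out sets. -/
theorem exists_strictMono_diagonal {M : Set ℕ} (hM : M.Infinite) (P : ℕ → ℕ → Set ℕ → Prop)
    (hP : ∀ k, ∀ j ∈ M, ∀ M' ⊆ M, M'.Infinite → ∃ L ⊆ M', L.Infinite ∧ P k j L) :
    ∃ (n : ℕ → ℕ) (L : ℕ → Set ℕ), StrictMono n ∧ (∀ k, n k ∈ M) ∧ (∀ k, P k (n k) (L k)) ∧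
      ∀ k j, k < j → n j ∈ L k := by
  have step : ∀ (k : ℕ) (A : {A : Set ℕ // A ⊆ M ∧ A.Infinite}),
      ∃ (j : ℕ) (B : {B : Set ℕ // B ⊆ M ∧ B.Infinite}) (L : Set ℕ),
        j ∈ A.1 ∧ B.1 ⊆ A.1 ∧ P k j L ∧ B.1 ⊆ L ∧ ∀ i ∈ B.1, j < i := by
    rintro k ⟨A, hAM, hA⟩
    obtain ⟨j, hj⟩ := hA.nonempty
    obtain ⟨L, hLA, hL, hPL⟩ := hP k j (hAM hj) A hAM hA
    refine ⟨j, ⟨L \ Set.Iic j, Set.sdiff_subset.trans (hLA.trans hAM),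
      hL.sdiff (Set.finite_Iic j)⟩, L, hj, Set.sdiff_subset.trans hLA, hPL, Set.sdiff_subset, ?_⟩
    rintro i ⟨-, hi⟩
    simpa using hi
  choose j B L hj hBA hPL hBL hlt using step
  let A : ℕ → {A : Set ℕ // A ⊆ M ∧ A.Infinite} := fun k =>
    Nat.rec ⟨M, subset_rfl, hM⟩ (fun k A => B k A) k
  have hA : ∀ k, A (k + 1) = B k (A k) := fun k => rfl
  have hanti : Antitone fun k => (A k).1 :=
    antitone_nat_of_succ_le fun k => by rw [hA]; exact hBA k (A k)
  have hmem : ∀ k i, k < i → j i (A i) ∈ (B k (A k)).1 := fun k i hki => by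
    rw [← hA]
    exact hanti (Nat.succ_le_of_lt hki) (hj i (A i))
  exact ⟨fun k => j k (A k), fun k => L k (A k), fun k i hki => hlt k _ _ (hmem k i hki),
    fun k => (A k).2.1 (hj k _), fun k => hPL k _, fun k i hki => hBL k _ (hmem k i hki)⟩

theorem diff_finite_of_eventually_mem {n : ℕ → ℕ} {T L : Set ℕ} (k : ℕ)
    (hT : T ⊆ Set.range n) (h : ∀ j, k < j → n j ∈ L) : (T \ L).Finite := by
  refine ((Set.finite_Iic k).image n).subset ?_
  rintro l ⟨hlT, hlL⟩
  obtain ⟨j, rfl⟩ := hT hlT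
  exact ⟨j, not_lt.1 fun hj => hlL (h j hj), rfl⟩

/-- Finitely many nowhere convergent sets can be split simultaneously. -/
theorem exists_split_nowhereConvergent {ι : Type*} [Finite ι] {C : Bool → ℕ → Set α}
    {S : ι → Set α} {M : Set ℕ} (hM : M.Infinite) (h : ∀ i, NowhereConvergent C (S i) M) :
    ∃ j ∈ M, ∃ M' ⊆ M, M'.Infinite ∧ ∀ i b, NowhereConvergent C (S i ∩ C b j) M' := by
  -- If every `j` fails, diagonalize over the witnesses `L k` of failure. By pigeonhole one pair
  -- `(i, b)` is to blame for infinitely many `k`. A point of `S i` oscillating along those `n k`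
  -- lies in some `C b (n k)`, and it oscillates along `L k`, which contains almost all of the
  -- sequence.
  by_contra! hcon
  obtain ⟨n, L, hn, hnM, hP, hL⟩ := exists_strictMono_diagonal hM
    (fun _ j L => ∃ q : ι × Bool, ∀ d ∈ S q.1 ∩ C q.2 j, ¬ OscillatesAlong C L d) (by
      intro _ j hj M' hM' hinf
      obtain ⟨i, b, hib⟩ := hcon j hj M' hM' hinf
      simp only [NowhereConvergent, not_forall, not_exists, not_and] at hib
      obtain ⟨L, hLM, hL, hd⟩ := hib
      exact ⟨L, hLM, hL, (i, b), hd⟩)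
  choose q hq using hP
  obtain ⟨⟨i, b⟩, hib⟩ := Finite.exists_infinite_fiber q
  have hT : (n '' (q ⁻¹' {(i, b)})).Infinite :=
    (Set.infinite_coe_iff.1 hib).image hn.injective.injOn
  obtain ⟨d, hdS, hd⟩ := h i (n '' (q ⁻¹' {(i, b)}))
    (by rintro _ ⟨k, -, rfl⟩; exact hnM k) hT
  obtain ⟨_, ⟨k, hk, rfl⟩, hdk⟩ := (hd b).nonempty
  have hk' : q k = (i, b) := hk
  have := hq k d
  rw [hk'] at this
  exact this ⟨hdS, hdk⟩
    (hd.of_diff_finite (diff_finite_of_eventually_mem k (Set.image_subset_range _ _) (hL k)))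

/-- Rosenthal's independence lemma: a nowhere convergent sequence of pairs of sets has a
subsequence all of whose finite Boolean combinations meet `S`. -/
theorem NowhereConvergent.exists_independent {C : Bool → ℕ → Set α} {S : Set α} {M : Set ℕ}
    (hM : M.Infinite) (h : NowhereConvergent C S M) :
    ∃ n : ℕ → ℕ, StrictMono n ∧
      ∀ (F : Finset ℕ) (ε : ℕ → Bool), ∃ d ∈ S, ∀ i ∈ F, d ∈ C (ε i) (n i) := by
  let Cell : Finset ℕ → (ℕ → Bool) → Set α := fun F ε => {d | d ∈ S ∧ ∀ i ∈ F, d ∈ C (ε i) i}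
  -- Invariant: every Boolean cell over the indices chosen so far is still nowhere convergent along
  -- the remaining indices.
  let State := {p : Finset ℕ × Set ℕ // p.2.Infinite ∧
    ∀ ε, NowhereConvergent C (Cell p.1 ε) p.2}
  have step : ∀ p : State, ∃ (j : ℕ) (p' : State), p'.1.1 = insert j p.1.1 ∧ j ∈ p.1.2 ∧
      ∀ m ∈ p'.1.2, j < m := by
    rintro ⟨⟨F, A⟩, hA, hF⟩
    obtain ⟨j, hj, A', -, hA', hC⟩ := exists_split_nowhereConvergent
      (S := fun ε : F → Bool => {d | d ∈ S ∧ ∀ i : F, d ∈ C (ε i) i}) hA (by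
        intro ε
        convert hF (fun i => if hi : i ∈ F then ε ⟨i, hi⟩ else true) using 1
        ext d
        refine and_congr_right fun _ => ⟨fun hd i hi => ?_, fun hd i => ?_⟩
        · simpa [hi] using hd ⟨i, hi⟩
        · simpa using hd i i.2)
    refine ⟨j, ⟨⟨insert j F, A' \ Set.Iic j⟩, hA'.sdiff (Set.finite_Iic j), ?_⟩, rfl, hj,
      fun m hm => by simpa using hm.2⟩
    intro ε
    convert (hC (fun i => ε i) (ε j)).mono Set.sdiff_subset using 1
    ext d
    simp only [Cell, Finset.mem_insert, Set.mem_ofPred_eq, Set.mem_inter_iff, forall_eq_or_imp,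
      Subtype.forall]
    tauto
  choose j next hF hj hlt using step
  let p : ℕ → State := fun k => Nat.rec
    ⟨⟨∅, M⟩, hM, fun ε => by simpa [Cell] using h⟩ (fun _ p => next p) k
  have hp : ∀ k, p (k + 1) = next (p k) := fun k => rfl
  have hFmono : Monotone fun k => (p k).1.1 := monotone_nat_of_le_succ fun k => by
    rw [hp, hF]; exact Finset.subset_insert _ _
  have hjmem : ∀ k, j (p k) ∈ (p (k + 1)).1.1 := fun k => by
    rw [hp, hF]; exact Finset.mem_insert_self _ _
  have hmono : StrictMono fun k => j (p k) := strictMono_nat_of_lt_succ fun k =>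
    hlt (p k) _ (by rw [← hp]; exact hj _)
  refine ⟨fun k => j (p k), hmono, fun F ε => ?_⟩
  obtain ⟨N, hN⟩ : ∃ N, ∀ i ∈ F, i < N :=
    ⟨F.sup id + 1, fun i hi => Nat.lt_succ_of_le (Finset.le_sup (f := id) hi)⟩
  -- Cells are indexed by the chosen integers and `ε` by their positions, hence `invFun`.
  -- Oscillation serves only to make the cell nonempty.
  obtain ⟨d, ⟨hdS, hd⟩, -⟩ := (p N).2.2 (fun m => ε (Function.invFun (fun k => j (p k)) m))
    _ subset_rfl (p N).2.1
  refine ⟨d, hdS, fun i hi => ?_⟩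
  have := hd (j (p i)) (hFmono (Nat.succ_le_of_lt (hN i hi)) (hjmem i))
  have hinv := Function.leftInverse_invFun hmono.injective i
  beta_reduce at hinv this
  rwa [hinv] at this

end Independence

/-! ### Rademacher averages and weakly null sequences in the dual -/

section Rademacher

/-- The sign of the `i`-th coordinate of the point of the discrete cube coded by `T`. -/
def rademacherSign (T : Finset ℕ) (i : ℕ) : ℝ := if i ∈ T then 1 else -1

theorem sum_powerset_rademacherSign {s : Finset ℕ} {i : ℕ} (hi : i ∈ s) :
    ∑ T ∈ s.powerset, rademacherSign T i = 0 := by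
  rw [← Finset.insert_erase hi, Finset.sum_powerset_insert (Finset.notMem_erase i s),
    ← Finset.sum_add_distrib]
  refine Finset.sum_eq_zero fun T hT => ?_
  have : i ∉ T := fun h => Finset.notMem_erase i s (Finset.mem_powerset.1 hT h)
  simp [rademacherSign, this]

/-- Orthogonality of the Rademacher functions: the cross terms with `c a` cancel between `T` and
`insert a T`. -/
theorem sum_powerset_sq_sum_rademacherSign (s : Finset ℕ) (c : ℕ → ℝ) :
    ∑ T ∈ s.powerset, (∑ i ∈ s, c i * rademacherSign T i) ^ 2 = 2 ^ s.card * ∑ i ∈ s, c i ^ 2 := by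
  induction s using Finset.induction_on with
  | empty => simp
  | insert a s ha ih =>
    have key : ∀ T ∈ s.powerset,
        (∑ i ∈ insert a s, c i * rademacherSign T i) ^ 2 +
          (∑ i ∈ insert a s, c i * rademacherSign (insert a T) i) ^ 2 =
        2 * (∑ i ∈ s, c i * rademacherSign T i) ^ 2 + 2 * c a ^ 2 := by
      intro T hT
      have haT : a ∉ T := fun h => ha (Finset.mem_powerset.1 hT h)
      have h2 : ∑ i ∈ s, c i * rademacherSign (insert a T) i =
          ∑ i ∈ s, c i * rademacherSign T i := Finset.sum_congr rfl fun i hi => by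
        have : i ≠ a := fun h => ha (h ▸ hi)
        simp [rademacherSign, this]
      rw [Finset.sum_insert ha, Finset.sum_insert ha, h2]
      simp only [rademacherSign, haT, Finset.mem_insert_self, if_true, if_false]
      ring
    rw [Finset.sum_powerset_insert ha, ← Finset.sum_add_distrib, Finset.sum_congr rfl key,
      Finset.sum_add_distrib, ← Finset.mul_sum, ih, Finset.sum_insert ha,
      Finset.card_insert_of_notMem ha, Finset.sum_const, Finset.card_powerset, nsmul_eq_mul]
    push_cast
    ring

variable {X : Type*} [NormedAddCommGroup X] [NormedSpace ℝ X]

/-- Rademacher averages of functionals that separate the terms of `a` independently. -/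
theorem exists_rademacher_average (a : ℕ → X) (r s : ℝ) (F : Finset ℕ)
    (h : ∀ ε : ℕ → Bool, ∃ d : X →L[ℝ] ℝ, ‖d‖ ≤ 1 ∧
      ∀ i ∈ F, (ε i = true → s ≤ d (a i)) ∧ (ε i = false → d (a i) ≤ r)) :
    ∃ φ : ℕ → (X →L[ℝ] ℝ), (∀ i, ‖φ i‖ ≤ 1) ∧ (∀ i ∈ F, (s - r) / 2 ≤ φ i (a i)) ∧
      ∀ (c : ℕ → ℝ) (x : X), (∑ i ∈ F, c i * φ i x) ^ 2 ≤ (∑ i ∈ F, c i ^ 2) * ‖x‖ ^ 2 := by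
  have h' : ∀ T : Finset ℕ, ∃ d : X →L[ℝ] ℝ, ‖d‖ ≤ 1 ∧
      ∀ i ∈ F, (i ∈ T → s ≤ d (a i)) ∧ (i ∉ T → d (a i) ≤ r) := fun T => by
    simpa using h fun i => decide (i ∈ T)
  choose d hd1 hd using h'
  have hpos : (0 : ℝ) < 2 ^ F.card := by positivity
  have hcard : ∑ _T ∈ F.powerset, (1 : ℝ) = 2 ^ F.card := by simp
  have hsign : ∀ T i, |rademacherSign T i| = 1 := fun T i => by
    unfold rademacherSign; split_ifs <;> simp
  refine ⟨fun i => (2 ^ F.card : ℝ)⁻¹ • ∑ T ∈ F.powerset, rademacherSign T i • d T, ?_, ?_, ?_⟩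
  · intro i
    rw [norm_smul, Real.norm_of_nonneg (by positivity), inv_mul_le_iff₀ hpos, mul_one, ← hcard]
    refine (norm_sum_le _ _).trans (Finset.sum_le_sum fun T _ => ?_)
    rw [norm_smul, Real.norm_eq_abs, hsign, one_mul]
    exact hd1 T
  · intro i hi
    simp only [smul_apply, sum_apply, smul_eq_mul]
    rw [le_inv_mul_iff₀ hpos]
    -- The added term has mean zero over the cube; with it the summand is `s` when `i ∈ T` and `-r`
    -- otherwise, a lower bound pointwise.
    calc (2 : ℝ) ^ F.card * ((s - r) / 2)
        = ∑ T ∈ F.powerset, ((s - r) / 2 + rademacherSign T i * ((s + r) / 2)) := by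
          rw [Finset.sum_add_distrib, ← Finset.sum_mul, sum_powerset_rademacherSign hi,
            Finset.sum_const, Finset.card_powerset, nsmul_eq_mul]
          push_cast
          ring
      _ ≤ _ := Finset.sum_le_sum fun T _ => by
          unfold rademacherSign
          split_ifs with hT
          · linarith [(hd T i hi).1 hT]
          · linarith [(hd T i hi).2 hT]
  · intro c x
    have hswap : ∑ i ∈ F, c i *
        ((2 ^ F.card : ℝ)⁻¹ • ∑ T ∈ F.powerset, rademacherSign T i • d T) x =
        (2 ^ F.card : ℝ)⁻¹ *
          ∑ T ∈ F.powerset, (∑ i ∈ F, c i * rademacherSign T i) * d T x := by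
      simp only [smul_apply, sum_apply, smul_eq_mul,
        Finset.mul_sum, Finset.sum_mul]
      rw [Finset.sum_comm]
      exact Finset.sum_congr rfl fun T _ => Finset.sum_congr rfl fun i _ => by ring
    have hdx : ∑ T ∈ F.powerset, d T x ^ 2 ≤ 2 ^ F.card * ‖x‖ ^ 2 := by
      rw [← hcard, Finset.sum_mul]
      refine Finset.sum_le_sum fun T _ => ?_
      rw [one_mul, ← sq_abs, ← Real.norm_eq_abs]
      gcongr
      simpa using (d T).le_of_opNorm_le (hd1 T) x
    -- Cauchy–Schwarz over the cube, then orthogonality of the signs.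
    rw [hswap, mul_pow, inv_pow, inv_mul_le_iff₀ (by positivity)]
    calc _ ≤ _ := Finset.sum_mul_sq_le_sq_mul_sq _ _ _
      _ ≤ (2 ^ F.card * ∑ i ∈ F, c i ^ 2) * (2 ^ F.card * ‖x‖ ^ 2) := by
          rw [sum_powerset_sq_sum_rademacherSign]
          gcongr
      _ = _ := by ring

/-- A sequence of functionals with an upper `ℓ₂` estimate is weakly null. -/
theorem isWeaklyNull_of_upper_two_estimate (φ : ℕ → (X →L[ℝ] ℝ))
    (h : ∀ (N : ℕ) (c : ℕ → ℝ) (x : X),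
      (∑ i ∈ Finset.range N, c i * φ i x) ^ 2 ≤ (∑ i ∈ Finset.range N, c i ^ 2) * ‖x‖ ^ 2) :
    IsWeaklyNull φ := by
  intro G
  -- Duality: evaluating `G` at `∑ G (φ i) • φ i`, of norm at most `√A`, gives `A ≤ ‖G‖ * √A`.
  have hsum : ∀ N, ∑ i ∈ Finset.range N, G (φ i) ^ 2 ≤ ‖G‖ ^ 2 := by
    intro N
    set A := ∑ i ∈ Finset.range N, G (φ i) ^ 2 with hA
    have hA0 : 0 ≤ A := Finset.sum_nonneg fun i _ => sq_nonneg _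
    have hnorm : ‖∑ i ∈ Finset.range N, G (φ i) • φ i‖ ≤ √A := by
      refine ContinuousLinearMap.opNorm_le_bound _ (Real.sqrt_nonneg _) fun x => ?_
      have := h N (fun i => G (φ i)) x
      rw [Real.norm_eq_abs]
      refine abs_le_of_sq_le_sq ?_ (by positivity)
      rw [mul_pow, Real.sq_sqrt hA0]
      simpa [sum_apply] using this
    have hG : A = G (∑ i ∈ Finset.range N, G (φ i) • φ i) := by
      simp [hA, sq]
    have hle : A ≤ ‖G‖ * √A := by
      calc A ≤ ‖G (∑ i ∈ Finset.range N, G (φ i) • φ i)‖ := by rw [← hG]; exact le_abs_self _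
        _ ≤ _ := G.le_opNorm_of_le hnorm
    have hs := Real.sq_sqrt hA0
    have h0 := Real.sqrt_nonneg A
    rw [← hs] at hle ⊢
    rw [Real.sqrt_sq h0] at hle
    rcases h0.eq_or_lt with h0 | h0
    · rw [← h0]; simp
    · gcongr
      exact le_of_mul_le_mul_right (by rwa [← sq]) h0
  have hs : Summable fun i => G (φ i) ^ 2 :=
    summable_of_sum_range_le (fun i => sq_nonneg _) hsum
  have := (hs.tendsto_atTop_zero).sqrt
  simp only [Real.sqrt_sq_eq_abs, Real.sqrt_zero] at this
  exact tendsto_zero_iff_abs_tendsto_zero _ |>.2 this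

/-- Functionals separating the terms of `a` independently give a weakly null sequence in the dual
that is bounded below on the terms of `a`. -/
theorem exists_isWeaklyNull_of_independent (a : ℕ → X) (r s : ℝ)
    (h : ∀ (F : Finset ℕ) (ε : ℕ → Bool), ∃ d : X →L[ℝ] ℝ, ‖d‖ ≤ 1 ∧
      ∀ i ∈ F, (ε i = true → s ≤ d (a i)) ∧ (ε i = false → d (a i) ≤ r)) :
    ∃ φ : ℕ → (X →L[ℝ] ℝ), IsWeaklyNull φ ∧ ∀ i, (s - r) / 2 ≤ φ i (a i) := by
  choose ψ hψ1 hψa hψ using fun N => exists_rademacher_average a r s (Finset.range N) (h _)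
  -- `ψ N` handles only the first `N` terms, so a weak* limit is taken by Banach–Alaoglu. Both the
  -- lower bound and the `ℓ₂` estimate are closed under pointwise limits.
  have hlim : ∀ i, ∃ φ : X →L[ℝ] ℝ, ∀ x,
      Tendsto (fun N => ψ N i x) (hyperfilter ℕ : Filter ℕ) (𝓝 (φ x)) := by
    intro i
    obtain ⟨φ, -, hφ⟩ := (WeakDual.isCompact_closedBall (0 : StrongDual ℝ X) 1).ultrafilter_le_nhds
      ((hyperfilter ℕ).map fun N => StrongDual.toWeakDual (ψ N i)) (by
        rw [le_principal_iff]
        refine Filter.mem_map.2 (Filter.univ_mem' fun N => ?_)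
        simpa using hψ1 N i)
    refine ⟨WeakDual.toStrongDual φ, fun x => ?_⟩
    exact ((WeakDual.eval_continuous x).tendsto φ).comp hφ
  choose φ hφ using hlim
  have hev : ∀ k, ∀ᶠ N in (hyperfilter ℕ : Filter ℕ), k < N := fun k =>
    (Nat.hyperfilter_le_atTop) (eventually_gt_atTop k)
  refine ⟨φ, isWeaklyNull_of_upper_two_estimate φ fun k c x => ?_, fun i => ?_⟩
  · refine le_of_tendsto ((tendsto_finsetSum _ fun i _ => (hφ i x).const_mul (c i)).pow 2) ?_
    filter_upwards [hev k] with N hN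
    have hsub : Finset.range k ⊆ Finset.range N := Finset.range_subset_range.2 hN.le
    have := hψ N (fun i => if i < k then c i else 0) x
    have e1 : ∑ i ∈ Finset.range N, (if i < k then c i else 0) * ψ N i x =
        ∑ i ∈ Finset.range k, c i * ψ N i x := by
      rw [← Finset.sum_subset hsub (by intro i _ hi; simp_all)]
      exact Finset.sum_congr rfl fun i hi => by simp_all
    have e2 : ∑ i ∈ Finset.range N, (if i < k then c i else 0) ^ 2 =
        ∑ i ∈ Finset.range k, c i ^ 2 := by
      rw [← Finset.sum_subset hsub (by intro i _ hi; simp_all)]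
      exact Finset.sum_congr rfl fun i hi => by simp_all
    rwa [e1, e2] at this
  · refine ge_of_tendsto (hφ i (a i)) ?_
    filter_upwards [hev i] with N hN using hψa N i (Finset.mem_range.2 hN)

end Rademacher

/-! ### Weak precompactness of Dunford–Pettis sets -/

section WeaklyCauchy

variable {X Y : Type*} [NormedAddCommGroup X] [NormedSpace ℝ X]
  [NormedAddCommGroup Y] [NormedSpace ℝ Y]

theorem IsDunfordPettisSet.mono {K L : Set X} (hK : IsDunfordPettisSet K) (h : L ⊆ K) :
    IsDunfordPettisSet L :=
  ⟨hK.1.subset h, fun φ hφ => (hK.2 φ hφ).mono h⟩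

/-- The sets of functionals that are larger than `s`, respectively smaller than `r`, at the terms
of a sequence. -/
def levelSets (a : ℕ → X) (r s : ℝ) (b : Bool) (n : ℕ) : Set (X →L[ℝ] ℝ) :=
  {φ | if b then s < φ (a n) else φ (a n) < r}

theorem IsDunfordPettisSet.not_nowhereConvergent {a : ℕ → X}
    (ha : IsDunfordPettisSet (Set.range a)) {r s : ℝ} (hrs : r < s) {M : Set ℕ}
    (hM : M.Infinite) :
    ¬ NowhereConvergent (levelSets a r s) (Metric.closedBall 0 1) M := by
  intro h
  obtain ⟨n, -, hind⟩ := h.exists_independent hM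
  obtain ⟨φ, hφ, hφa⟩ := exists_isWeaklyNull_of_independent (a ∘ n) r s (by
    intro F ε
    obtain ⟨d, hd1, hd⟩ := hind F ε
    refine ⟨d, by simpa using hd1, fun i hi => ⟨fun hε => ?_, fun hε => ?_⟩⟩ <;>
    · have := hd i hi
      simp only [levelSets, hε, Set.mem_ofPred_eq] at this
      simpa using this.le)
  have hunif := Metric.tendstoUniformlyOn_iff.1 (ha.2 φ hφ) ((s - r) / 2) (by linarith)
  obtain ⟨i, hi⟩ := hunif.exists
  have h1 := hi (a (n i)) ⟨n i, rfl⟩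
  rw [dist_zero_left, Real.norm_eq_abs] at h1
  exact absurd ((hφa i).trans (le_abs_self _)) (not_le.2 h1)

/-- Every sequence whose terms form a Dunford–Pettis set has a weakly Cauchy subsequence. -/
theorem IsDunfordPettisSet.exists_isWeaklyCauchy_subseq {a : ℕ → X}
    (ha : IsDunfordPettisSet (Set.range a)) :
    ∃ n : ℕ → ℕ, StrictMono n ∧ IsWeaklyCauchy (a ∘ n) := by
  obtain ⟨e, he⟩ := exists_surjective_nat (ℚ × ℚ)
  -- Stage `k` rules out oscillation across the `k`-th rational pair, for all functionals of the
  -- unit ball at once.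
  obtain ⟨n, L, hn, -, hP, hL⟩ := exists_strictMono_diagonal Set.infinite_univ
    (fun k _ L => (e k).1 < (e k).2 → ∀ d ∈ Metric.closedBall (0 : X →L[ℝ] ℝ) 1,
      ¬ OscillatesAlong (levelSets a (e k).1 (e k).2) L d) (by
    intro k _ _ M _ hM
    by_cases hk : (e k).1 < (e k).2
    · have := ha.not_nowhereConvergent (r := (e k).1) (s := (e k).2) (by exact_mod_cast hk) hM
      simp only [NowhereConvergent, not_forall, not_exists, not_and] at this
      obtain ⟨L, hLM, hL, hd⟩ := this
      exact ⟨L, hLM, hL, fun _ => hd⟩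
    · exact ⟨M, subset_rfl, hM, fun h => absurd h hk⟩)
  refine ⟨n, hn, ?_⟩
  obtain ⟨R, hR⟩ := ha.1.exists_norm_le
  have hball : ∀ φ ∈ Metric.closedBall (0 : X →L[ℝ] ℝ) 1,
      CauchySeq fun k => φ ((a ∘ n) k) := by
    intro φ hφ
    have hb : ∀ k, |φ (a (n k))| ≤ R := fun k => by
      have h1 := φ.le_of_opNorm_le (mem_closedBall_zero_iff.1 hφ) (a (n k))
      rw [one_mul] at h1
      exact h1.trans (hR _ ⟨n k, rfl⟩)
    obtain ⟨c, hc⟩ := tendsto_of_no_upcrossings (u := fun k => φ (a (n k))) (f := atTop)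
      (s := Set.range ((↑) : ℚ → ℝ)) Rat.isDenseEmbedding_coe_real.dense (by
        rintro _ ⟨r, rfl⟩ _ ⟨s, rfl⟩ hrs ⟨hr, hs⟩
        obtain ⟨k, hk⟩ := he (r, s)
        have hPk := hP k
        rw [hk] at hPk
        refine hPk (by exact_mod_cast hrs) φ hφ (OscillatesAlong.of_diff_finite (T := Set.range n)
          ?_ (diff_finite_of_eventually_mem k subset_rfl (hL k)))
        have himg : ∀ (b : Bool), (∃ᶠ i in atTop, φ ∈ levelSets a (r : ℝ) s b (n i)) →
            {l | l ∈ Set.range n ∧ φ ∈ levelSets a (r : ℝ) s b l}.Infinite := fun b hfreq => by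
          refine ((Nat.frequently_atTop_iff_infinite.1 hfreq).image hn.injective.injOn).mono ?_
          rintro _ ⟨i, hi, rfl⟩
          exact ⟨⟨i, rfl⟩, hi⟩
        intro b
        cases b
        · exact himg _ (by simpa [levelSets] using hr)
        · exact himg _ (by simpa [levelSets] using hs))
      (isBoundedUnder_of ⟨R, fun k => (abs_le.1 (hb k)).2⟩)
      (isBoundedUnder_of ⟨-R, fun k => (abs_le.1 (hb k)).1⟩)
    exact hc.cauchySeq
  intro φ
  obtain ⟨t, ht, hφ⟩ : ∃ t : ℝ, 0 < t ∧ ‖φ‖ ≤ t := ⟨‖φ‖ + 1, by positivity, by simp⟩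
  have h1 := hball (t⁻¹ • φ) (by
    rw [mem_closedBall_zero_iff, norm_smul, Real.norm_of_nonneg (by positivity),
      inv_mul_le_iff₀ ht]
    simpa using hφ)
  obtain ⟨c, hc⟩ := cauchySeq_tendsto_of_complete h1
  have h2 := hc.const_mul t
  simp only [smul_apply, smul_eq_mul, mul_inv_cancel_left₀ ht.ne'] at h2
  exact h2.cauchySeq

/-- Norm convergent sequences in `DPC p X Y` act on `p`-Right null sequences uniformly. -/
theorem IsPRightNull.tendsto_apply_of_tendsto {p : ℝ≥0∞} {x : ℕ → X} (hx : IsPRightNull p x)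
    {T : ℕ → (X →L[ℝ] Y)} (hT : ∀ n, T n ∈ DPC p X Y) {S : X →L[ℝ] Y}
    (hTS : Tendsto T atTop (𝓝 S)) {m : ℕ → ℕ} (hm : Tendsto m atTop atTop) :
    Tendsto (fun n => T n (x (m n))) atTop (𝓝 0) := by
  obtain ⟨R, hR⟩ := hx.2.1.exists_norm_le
  have hxR : ∀ n, ‖x n‖ ≤ R := fun n => hR _ ⟨n, rfl⟩
  have hTn : Tendsto (fun n => ‖T n - S‖) atTop (𝓝 0) :=
    tendsto_iff_norm_sub_tendsto_zero.1 hTS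
  have hunif : TendstoUniformly (fun n k => T n (x k)) (fun k => S (x k)) atTop := by
    rw [Metric.tendstoUniformly_iff]
    intro ε hε
    have h1 : Tendsto (fun n => ‖T n - S‖ * R) atTop (𝓝 0) := by simpa using hTn.mul_const R
    filter_upwards [h1.eventually_lt_const hε] with n hn k
    rw [dist_comm, dist_eq_norm, ← sub_apply]
    exact ((T n - S).le_opNorm_of_le (hxR k)).trans_lt hn
  -- Interchange of limits: `T n → S` uniformly on the bounded sequence `x`, so `S` inherits the
  -- null limit.
  have hS : Tendsto (fun k => S (x k)) atTop (𝓝 0) :=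
    hunif.tendsto_of_eventually_tendsto (.of_forall fun n => hT n x hx) tendsto_const_nhds
  have h2 : Tendsto (fun n => (T n - S) (x (m n))) atTop (𝓝 0) :=
    squeeze_zero_norm (fun n => (T n - S).le_opNorm_of_le (hxR (m n)))
      (by simpa using hTn.mul_const R)
  simpa using h2.add (hS.comp hm)

end WeaklyCauchy

/-! ### The derivative on Dunford–Pettis sets -/

theorem propositionp2 {X Y : Type*} [NormedAddCommGroup X] [NormedSpace ℝ X] [CompleteSpace X]
    [NormedAddCommGroup Y] [NormedSpace ℝ Y] [CompleteSpace Y]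
    (p : ℝ≥0∞) (hp1 : 1 ≤ p) (hp : p ≠ ∞)
    (U : Set X) (hUo : IsOpen U) (hUc : Convex ℝ U)
    (f : X → Y) (hf : DifferentiableOn ℝ f U)
    (hf' : ∀ x ∈ U, fderiv ℝ f x ∈ DPC p X Y)
    (hcont : IsRightSeqContinuousOn U (fderiv ℝ f)) :
    ∀ K : Set X, IsDunfordPettisSet K → IsUBounded U K →
      IsPDPLSet p (fderiv ℝ f '' K) := by
  intro K hK hKU x hx
  rw [ENNReal.tendsto_nhds_zero]
  intro ε hε
  by_contra hcon
  obtain ⟨m, hm, hlt⟩ := extraction_of_frequently_atTop (not_eventually.1 hcon)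
  have hex : ∀ k, ∃ a ∈ K, ε < ‖fderiv ℝ f a (x (m k))‖ₑ := by
    intro k
    by_contra! hle
    refine hlt k (iSup₂_le ?_)
    rintro _ ⟨a, ha, rfl⟩
    exact hle a ha
  choose a haK ha using hex
  have hrange : Set.range a ⊆ K := Set.range_subset_iff.2 haK
  obtain ⟨n, hn, hcauchy⟩ := (hK.mono hrange).exists_isWeaklyCauchy_subseq
  have hrange' : Set.range (a ∘ n) ⊆ K := (Set.range_comp_subset_range n a).trans hrange
  obtain ⟨hsub, hbdd, δ, hδ, hdist⟩ := hKU
  obtain ⟨S, hS⟩ := hcont (a ∘ n)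
    ⟨hrange'.trans hsub, hbdd.subset hrange', δ, hδ, fun y hy => hdist y (hrange' hy)⟩
    ⟨hcauchy, hK.mono hrange'⟩
  -- The point `a (n k)` was chosen for `x (m (n k))`, so the vectors are followed along `m ∘ n`.
  have hlim := hx.tendsto_apply_of_tendsto (fun k => hf' _ (hsub (haK (n k)))) hS
    (hm.comp hn).tendsto_atTop
  have hlim' := hlim.enorm
  rw [enorm_zero] at hlim'
  obtain ⟨k, hk⟩ := (hlim'.eventually_lt_const hε).exists
  exact (ha (n k)).not_gt hk
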